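/- Let $(\mathcal C,\mathbb E,\mathfrak s)$ be an extriangulated category (in the sense of Nakaoka and Palu) satisfying Condition (WIC): if $gf$ is an inflation then so is $f$, and if $gf$ is a deflation then so is $g$. Let $\xi$ be a proper class of $\mathbb E$-triangles, i.e. a class of $\mathbb E$-triangles closed under isomorphisms, finite coproducts, base change and cobase change, containing all split $\mathbb E$-triangles, and saturated (if $A_2\to B_2\xrightarrow{y_2}C\dashrightarrow$ and a realization of $y_2^*\delta_1$ lie in $\xi$, where $A_1\to B_1\to C\overset{\delta_1}{\dashrightarrow}$ is an $\mathbb E$-triangle, then the latter lies in $\xi$). Assume that $\mathcal C$ has enough $\xi$-projectives and enough $\xi$-injectives. Let $\mathcal W$ be a class of objects of $\mathcal C$ closed under finite direct sums. An $\mathbb E$-triangle $A\to B\to C\dashrightarrow$ in $\xi$ is called $\mathcal C(\mathcal W,-)$-exact if $0\to\mathcal C(W,A)\to\mathcal C(W,B)\to\mathcal C(W,C)\to0$ is exact for all $W\in\mathcal W$, and $\mathcal C(-,\mathcal W)$-exact if $0\to\mathcal C(C,W)\to\mathcal C(B,W)\to\mathcal C(A,W)\to0$ is exact for all $W\in\mathcal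 W$. A complex $W^n\to\cdots\to W^1\to W^0\to A\to0$ (or, for $n=\infty$, $\cdots\to W^1\to W^0\to A\to0$) is called $\mathcal C(\mathcal W,-)$-exact (respectively $\mathcal C(-,\mathcal W)$-exact) if there are $\mathcal C(\mathcal W,-)$-exact (respectively $\mathcal C(-,\mathcal W)$-exact) $\mathbb E$-triangles $K^{i+1}\xrightarrow{g^i}W^i\xrightarrow{f^i}K^i\dashrightarrow$ in $\xi$ for all $0\le i\le n$ ($i<\infty$), with $K^0=A$, such that $W^0\to A$ is $f^0$ and $W^{i+1}\to W^i$ is $g^if^{i+1}$. If the complex is to start with $0\to W^n$, it is required moreover that $K^{n+1}=0$. It is a proper $\mathcal W(\xi)$-resolution of $A$ (of length $n$) if all $W^i$ are in $\mathcal W$ and it is $\mathcal C(\mathcal W,-)$-exact. Let $X_1\to X_0\to X\dashrightarrow$ be a $\mathcal C(\mathcal W,-)$-exact $\mathbb E$-triangle in $\xi$, let $0\le n\le\infty$, and let $$W_0^n\to\cdots\to W_0^1\to W_0^0\to X_0\to0\qquad(1)$$ $$W_1^{n-1}\to\cdots\to W_1^1\to W_1^0\to X_1\to0\qquad(2)$$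 be proper $\mathcal W(\xi)$-resolutions of $X_0$ and $X_1$ (for $n=\infty$ both are infinite to the left; for $n=0$ the second has no terms $W_1^i$). Then there is a proper $\mathcal W(\xi)$-resolution of $X$ of the form $$W_0^n\oplus W_1^{n-1}\to\cdots\to W_0^2\oplus W_1^1\to W_0^1\oplus W_1^0\to W_0^0\to X\to0\qquad(3)$$ such that, if in addition the complexes (1), (2) and the $\mathbb E$-triangle $X_1\to X_0\to X\dashrightarrow$ are $\mathcal C(-,\mathcal W)$-exact, then (3) is $\mathcal C(-,\mathcal W)$-exact as well. The same holds when, for $n<\infty$, the three complexes are taken to start with $0\to$ on the left. -/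

import Mathlib

open CategoryTheory CategoryTheory.Limits Opposite

universe w v u

/-- A sequence `A ⟶ B ⟶ Z` with fixed end terms `A` and `Z`. -/
structure SeqBetween {𝒞 : Type u} [Category.{v} 𝒞] (A Z : 𝒞) where
  mid : 𝒞
  inc : A ⟶ mid
  prj : mid ⟶ Z

/-- Two sequences `A ⟶ B ⟶ Z` and `A ⟶ B' ⟶ Z` are equivalent if there is an isomorphism `B ≅ B'`
compatible with the identities of `A` and `Z`. -/
def seqSetoid {𝒞 : Type u} [Category.{v} 𝒞] (A Z : 𝒞) : Setoid (SeqBetween A Z) where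
  r S S' := ∃ b : S.mid ≅ S'.mid, S.inc ≫ b.hom = S'.inc ∧ b.hom ≫ S'.prj = S.prj
  iseqv :=
    { refl := fun S => ⟨Iso.refl _, by simp, by simp⟩
      symm := by
        rintro S S' ⟨b, h₁, h₂⟩
        exact ⟨b.symm, by simp [← h₁], by simp [← h₂]⟩
      trans := by
        rintro S S' S'' ⟨b, h₁, h₂⟩ ⟨b', h₁', h₂'⟩
        exact ⟨b ≪≫ b', by simp [← h₁', ← h₁], by simp [← h₂, ← h₂']⟩ }

/-- The equivalence class `[A ⟶ B ⟶ Z]`. -/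
def seqClass {𝒞 : Type u} [Category.{v} 𝒞] {A B Z : 𝒞} (x : A ⟶ B) (y : B ⟶ Z) :
    Quotient (seqSetoid A Z) :=
  Quotient.mk (seqSetoid A Z) ⟨B, x, y⟩

/-- A bifunctor `𝔼 : 𝒞ᵒᵖ × 𝒞 ⥤ Ab`. -/
abbrev ExtBifunctor (𝒞 : Type u) [Category.{v} 𝒞] := 𝒞ᵒᵖ ⥤ 𝒞 ⥤ AddCommGrpCat.{w}

namespace ExtBifunctor

variable {𝒞 : Type u} [Category.{v} 𝒞] (E : ExtBifunctor.{w} 𝒞)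

/-- The group `𝔼(Z, A)` of extensions. -/
abbrev ext (Z A : 𝒞) : Type w := (E.obj (op Z)).obj A

/-- `a_* δ` for `a : A ⟶ A'` and `δ ∈ 𝔼(Z, A)`. -/
def push {Z A A' : 𝒞} (a : A ⟶ A') (δ : E.ext Z A) : E.ext Z A' :=
  ((E.obj (op Z)).map a).hom δ

/-- `c^* δ` for `c : Z' ⟶ Z` and `δ ∈ 𝔼(Z, A)`. -/
def pull {Z Z' A : 𝒞} (c : Z' ⟶ Z) (δ : E.ext Z A) : E.ext Z' A :=
  ((E.map c.op).app A).hom δ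

/-- The direct sum `δ ⊕ δ' ∈ 𝔼(Z ⊞ Z', A ⊞ A')` of two extensions: the element with components
`(δ, 0, 0, δ')`. -/
noncomputable def directSum [Preadditive 𝒞] [HasZeroObject 𝒞] [HasBinaryBiproducts 𝒞] {Z Z' A A' : 𝒞}
    (δ : E.ext Z A) (δ' : E.ext Z' A') : E.ext (Z ⊞ Z') (A ⊞ A') :=
  E.push biprod.inl (E.pull biprod.fst δ) + E.push biprod.inr (E.pull biprod.snd δ')

end ExtBifunctor

/-- The structure of an extriangulated category (in the sense of Nakaoka and Palu) on an additive
category `𝒞`. -/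
structure Extriangulation (𝒞 : Type u) [Category.{v} 𝒞] [Preadditive 𝒞]
    [HasZeroObject 𝒞] [HasBinaryBiproducts 𝒞] where
  /-- the bifunctor `𝔼` -/
  E : ExtBifunctor.{w} 𝒞
  /-- the realization `𝔰` -/
  s : ∀ {A Z : 𝒞}, E.ext Z A → Quotient (seqSetoid A Z)
  /-- (ET1): `𝔼` is additive in both variables -/
  push_add : ∀ {Z A A' : 𝒞} (a a' : A ⟶ A') (δ : E.ext Z A),
    E.push (a + a') δ = E.push a δ + E.push a' δ
  pull_add : ∀ {Z Z' A : 𝒞} (c c' : Z' ⟶ Z) (δ : E.ext Z A),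
    E.pull (c + c') δ = E.pull c δ + E.pull c' δ
  /-- (ET2): `𝔰` is a realization ... -/
  realization : ∀ {A B Z A' B' Z' : 𝒞} {δ : E.ext Z A} {δ' : E.ext Z' A'}
    {x : A ⟶ B} {y : B ⟶ Z} {x' : A' ⟶ B'} {y' : B' ⟶ Z'} (a : A ⟶ A') (c : Z ⟶ Z'),
    s δ = seqClass x y → s δ' = seqClass x' y' → E.push a δ = E.pull c δ' →
    ∃ b : B ⟶ B', x ≫ b = a ≫ x' ∧ y ≫ c = b ≫ y'
  /-- ... which is additive -/
  s_zero : ∀ (A Z : 𝒞),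
    s (0 : E.ext Z A) = seqClass (biprod.inl : A ⟶ A ⊞ Z) (biprod.snd : A ⊞ Z ⟶ Z)
  s_directSum : ∀ {A B Z A' B' Z' : 𝒞} {δ : E.ext Z A} {δ' : E.ext Z' A'}
    {x : A ⟶ B} {y : B ⟶ Z} {x' : A' ⟶ B'} {y' : B' ⟶ Z'},
    s δ = seqClass x y → s δ' = seqClass x' y' →
    s (E.directSum δ δ') = seqClass (biprod.map x x') (biprod.map y y')
  /-- (ET3) -/
  et3 : ∀ {A B Z A' B' Z' : 𝒞} {δ : E.ext Z A} {δ' : E.ext Z' A'}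
    {x : A ⟶ B} {y : B ⟶ Z} {x' : A' ⟶ B'} {y' : B' ⟶ Z'} (a : A ⟶ A') (b : B ⟶ B'),
    s δ = seqClass x y → s δ' = seqClass x' y' → x ≫ b = a ≫ x' →
    ∃ c : Z ⟶ Z', y ≫ c = b ≫ y' ∧ E.push a δ = E.pull c δ'
  /-- (ET3)ᵒᵖ -/
  et3_op : ∀ {A B Z A' B' Z' : 𝒞} {δ : E.ext Z A} {δ' : E.ext Z' A'}
    {x : A ⟶ B} {y : B ⟶ Z} {x' : A' ⟶ B'} {y' : B' ⟶ Z'} (b : B ⟶ B') (c : Z ⟶ Z'),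
    s δ = seqClass x y → s δ' = seqClass x' y' → y ≫ c = b ≫ y' →
    ∃ a : A ⟶ A', x ≫ b = a ≫ x' ∧ E.push a δ = E.pull c δ'
  /-- (ET4) -/
  et4 : ∀ {A B D M F : 𝒞} {δ : E.ext D A} {δ' : E.ext F B}
    {f : A ⟶ B} {f' : B ⟶ D} {g : B ⟶ M} {g' : M ⟶ F},
    s δ = seqClass f f' → s δ' = seqClass g g' →
    ∃ (G : 𝒞) (h' : M ⟶ G) (d : D ⟶ G) (e : G ⟶ F) (δ'' : E.ext G A),
      f' ≫ d = g ≫ h' ∧ h' ≫ e = g' ∧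
      s δ'' = seqClass (f ≫ g) h' ∧
      s (E.push f' δ') = seqClass d e ∧
      E.pull d δ'' = δ ∧ E.push f δ'' = E.pull e δ'
  /-- (ET4)ᵒᵖ -/
  et4_op : ∀ {D A B F Z : 𝒞} {δ : E.ext B D} {δ' : E.ext Z F}
    {f' : D ⟶ A} {f : A ⟶ B} {g' : F ⟶ B} {g : B ⟶ Z},
    s δ = seqClass f' f → s δ' = seqClass g' g →
    ∃ (G : 𝒞) (h' : G ⟶ A) (d : D ⟶ G) (e : G ⟶ F) (δ'' : E.ext Z G),
      d ≫ h' = f' ∧ h' ≫ f = e ≫ g' ∧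
      s δ'' = seqClass h' (f ≫ g) ∧
      s (E.pull g' δ) = seqClass d e ∧
      E.push e δ'' = δ' ∧ E.push d δ = E.pull g δ''

/-- The sequence `0 ⟶ 𝒞(P, A) ⟶ 𝒞(P, B) ⟶ 𝒞(P, Z) ⟶ 0` induced by `x` and `y` is exact. -/
def CovHomExact {𝒞 : Type u} [Category.{v} 𝒞] [Preadditive 𝒞] (P : 𝒞) {A B Z : 𝒞}
    (x : A ⟶ B) (y : B ⟶ Z) : Prop :=
  Function.Injective (fun f : P ⟶ A => f ≫ x) ∧
  Function.Exact (fun f : P ⟶ A => f ≫ x) (fun f : P ⟶ B => f ≫ y) ∧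
  Function.Surjective (fun f : P ⟶ B => f ≫ y)

/-- The sequence `0 ⟶ 𝒞(Z, I) ⟶ 𝒞(B, I) ⟶ 𝒞(A, I) ⟶ 0` induced by `x` and `y` is exact. -/
def ContraHomExact {𝒞 : Type u} [Category.{v} 𝒞] [Preadditive 𝒞] (I : 𝒞) {A B Z : 𝒞}
    (x : A ⟶ B) (y : B ⟶ Z) : Prop :=
  Function.Injective (fun f : Z ⟶ I => y ≫ f) ∧
  Function.Exact (fun f : Z ⟶ I => y ≫ f) (fun f : B ⟶ I => x ≫ f) ∧
  Function.Surjective (fun f : B ⟶ I => x ≫ f)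

/-- How a sequence of finite length stops on the left:
`cut` stands for `Wₙ ⟶ ⋯ ⟶ W₀ ⟶ A ⟶ 0` with no condition to the left of `Wₙ`,
`zero` stands for `0 ⟶ Wₙ ⟶ ⋯ ⟶ W₀ ⟶ A ⟶ 0`. -/
inductive LeftEnd
  | cut
  | zero

namespace Extriangulation

variable {𝒞 : Type u} [Category.{v} 𝒞] [Preadditive 𝒞] [HasZeroObject 𝒞] [HasBinaryBiproducts 𝒞]

/-- An `𝔼`-triangle `A ⟶ B ⟶ Z ⇢ δ`, i.e. `𝔰(δ) = [A ⟶ B ⟶ Z]`. -/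
structure ETriangle (T : Extriangulation.{w} 𝒞) where
  {A : 𝒞}
  {B : 𝒞}
  {Z : 𝒞}
  x : A ⟶ B
  y : B ⟶ Z
  δ : T.E.ext Z A
  real : T.s δ = seqClass x y

variable (T : Extriangulation.{w} 𝒞)

variable {T} in
/-- Isomorphism of `𝔼`-triangles. -/
def ETriangle.IsIso (t t' : T.ETriangle) : Prop :=
  ∃ (a : t.A ≅ t'.A) (b : t.B ≅ t'.B) (c : t.Z ≅ t'.Z),
    t.x ≫ b.hom = a.hom ≫ t'.x ∧ t.y ≫ c.hom = b.hom ≫ t'.y ∧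
    T.E.push a.hom t.δ = T.E.pull c.hom t'.δ

variable {T} in
/-- The coproduct of two `𝔼`-triangles. -/
noncomputable def ETriangle.coprod (t t' : T.ETriangle) : T.ETriangle where
  x := biprod.map t.x t'.x
  y := biprod.map t.y t'.y
  δ := T.E.directSum t.δ t'.δ
  real := T.s_directSum t.real t'.real

/-- Proper classes of `𝔼`-triangles. (The empty coproduct is a split `𝔼`-triangle. In `saturated`,
`y₂^* δ₁` may be realized by any sequence, since all its realizations are equivalent.) -/
structure IsProperClass (ξ : Set T.ETriangle) : Prop where
  iso_closed : ∀ t t' : T.ETriangle, t ∈ ξ → t.IsIso t' → t' ∈ ξ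
  coprod : ∀ t t' : T.ETriangle, t ∈ ξ → t' ∈ ξ → t.coprod t' ∈ ξ
  split : ∀ t : T.ETriangle, t.δ = 0 → t ∈ ξ
  baseChange : ∀ {A B Z B' Z' : 𝒞} {x : A ⟶ B} {y : B ⟶ Z} {δ : T.E.ext Z A}
    (h : T.s δ = seqClass x y) (c : Z' ⟶ Z) {x' : A ⟶ B'} {y' : B' ⟶ Z'}
    (h' : T.s (T.E.pull c δ) = seqClass x' y'),
    (⟨x, y, δ, h⟩ : T.ETriangle) ∈ ξ → (⟨x', y', T.E.pull c δ, h'⟩ : T.ETriangle) ∈ ξ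
  cobaseChange : ∀ {A B Z A' B' : 𝒞} {x : A ⟶ B} {y : B ⟶ Z} {δ : T.E.ext Z A}
    (h : T.s δ = seqClass x y) (a : A ⟶ A') {x' : A' ⟶ B'} {y' : B' ⟶ Z}
    (h' : T.s (T.E.push a δ) = seqClass x' y'),
    (⟨x, y, δ, h⟩ : T.ETriangle) ∈ ξ → (⟨x', y', T.E.push a δ, h'⟩ : T.ETriangle) ∈ ξ
  saturated : ∀ {A₁ B₁ A₂ B₂ M Z : 𝒞} {x₁ : A₁ ⟶ B₁} {y₁ : B₁ ⟶ Z} {δ₁ : T.E.ext Z A₁}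
    {x₂ : A₂ ⟶ B₂} {y₂ : B₂ ⟶ Z} {δ₂ : T.E.ext Z A₂} {m : A₁ ⟶ M} {e : M ⟶ B₂}
    (h₁ : T.s δ₁ = seqClass x₁ y₁) (h₂ : T.s δ₂ = seqClass x₂ y₂)
    (h : T.s (T.E.pull y₂ δ₁) = seqClass m e),
    (⟨x₂, y₂, δ₂, h₂⟩ : T.ETriangle) ∈ ξ →
    (⟨m, e, T.E.pull y₂ δ₁, h⟩ : T.ETriangle) ∈ ξ →
    (⟨x₁, y₁, δ₁, h₁⟩ : T.ETriangle) ∈ ξ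

/-- `ξ`-projective objects. -/
def IsProjective (ξ : Set T.ETriangle) (P : 𝒞) : Prop :=
  ∀ t ∈ ξ, CovHomExact P t.x t.y

/-- `ξ`-injective objects. -/
def IsInjective (ξ : Set T.ETriangle) (I : 𝒞) : Prop :=
  ∀ t ∈ ξ, ContraHomExact I t.x t.y

/-- There are enough `ξ`-projectives. -/
def EnoughProjectives (ξ : Set T.ETriangle) : Prop :=
  ∀ A : 𝒞, ∃ (K P : 𝒞) (x : K ⟶ P) (y : P ⟶ A) (δ : T.E.ext A K) (h : T.s δ = seqClass x y),
    (⟨x, y, δ, h⟩ : T.ETriangle) ∈ ξ ∧ T.IsProjective ξ P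

/-- There are enough `ξ`-injectives. -/
def EnoughInjectives (ξ : Set T.ETriangle) : Prop :=
  ∀ A : 𝒞, ∃ (I K : 𝒞) (x : A ⟶ I) (y : I ⟶ K) (δ : T.E.ext K A) (h : T.s δ = seqClass x y),
    (⟨x, y, δ, h⟩ : T.ETriangle) ∈ ξ ∧ T.IsInjective ξ I

/-- `f` is an inflation. -/
def IsInflation {A B : 𝒞} (f : A ⟶ B) : Prop :=
  ∃ (Z : 𝒞) (y : B ⟶ Z) (δ : T.E.ext Z A), T.s δ = seqClass f y

/-- `f` is a deflation. -/
def IsDeflation {B Z : 𝒞} (f : B ⟶ Z) : Prop :=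
  ∃ (A : 𝒞) (x : A ⟶ B) (δ : T.E.ext Z A), T.s δ = seqClass x f

/-- Condition (WIC). -/
def WIC : Prop :=
  (∀ {A B Z : 𝒞} (f : A ⟶ B) (g : B ⟶ Z), T.IsInflation (f ≫ g) → T.IsInflation f) ∧
  (∀ {A B Z : 𝒞} (f : A ⟶ B) (g : B ⟶ Z), T.IsDeflation (f ≫ g) → T.IsDeflation g)

/-- The `𝒞(𝒲, -)`-exact `𝔼`-triangles in `ξ`. -/
def covExact (ξ : Set T.ETriangle) (𝒲 : ObjectProperty 𝒞) : Set T.ETriangle :=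
  {t | t ∈ ξ ∧ ∀ W, 𝒲 W → CovHomExact W t.x t.y}

/-- The `𝒞(-, 𝒲)`-exact `𝔼`-triangles in `ξ`. -/
def contraExact (ξ : Set T.ETriangle) (𝒲 : ObjectProperty 𝒞) : Set T.ETriangle :=
  {t | t ∈ ξ ∧ ∀ W, 𝒲 W → ContraHomExact W t.x t.y}

/-- A sequence `⋯ ⟶ W₁ ⟶ W₀ ⟶ A ⟶ 0` with `N` terms `Wᵢ`, `0 ≤ i < N` (where `N = ∞` is allowed),
is a complex which is spliced from `𝔼`-triangles `Kᵢ₊₁ ⟶ Wᵢ ⟶ Kᵢ`, `0 ≤ i < N`, in the class `S`,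
where `K₀` is `A`. If `N` is finite and the sequence starts with `0 ⟶ W_{N-1}`, then `K_N` is zero.
The values of `W` and `d` beyond this range play no role. -/
def IsExactSeq (S : Set T.ETriangle) (N : ℕ∞) (l : LeftEnd) (A : 𝒞) (W : ℕ → 𝒞)
    (d : ∀ i, W (i + 1) ⟶ W i) (ε : W 0 ⟶ A) : Prop :=
  (1 < N → d 0 ≫ ε = 0) ∧
  (∀ i : ℕ, ((i + 2 : ℕ) : ℕ∞) < N → d (i + 1) ≫ d i = 0) ∧
  ∃ (K : ℕ → 𝒞) (α : K 0 ≅ A) (g : ∀ i, K (i + 1) ⟶ W i) (f : ∀ i, W i ⟶ K i)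
    (δ : ∀ i, T.E.ext (K i) (K (i + 1))),
    (∀ i : ℕ, (i : ℕ∞) < N →
      ∃ h : T.s (δ i) = seqClass (g i) (f i), (⟨g i, f i, δ i, h⟩ : T.ETriangle) ∈ S) ∧
    (0 < N → ε = f 0 ≫ α.hom) ∧
    (∀ i : ℕ, ((i + 1 : ℕ) : ℕ∞) < N → d i = f (i + 1) ≫ g i) ∧
    (l = LeftEnd.zero → ∀ n : ℕ, (n : ℕ∞) = N → IsZero (K n))

/-- `⋯ ⟶ W₁ ⟶ W₀ ⟶ A ⟶ 0` (with `N` terms `Wᵢ`) is a proper `𝒲(ξ)`-resolution of `A`. -/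
def IsProperResolution (ξ : Set T.ETriangle) (𝒲 : ObjectProperty 𝒞) (N : ℕ∞) (l : LeftEnd)
    (A : 𝒞) (W : ℕ → 𝒞) (d : ∀ i, W (i + 1) ⟶ W i) (ε : W 0 ⟶ A) : Prop :=
  (∀ i : ℕ, (i : ℕ∞) < N → 𝒲 (W i)) ∧ T.IsExactSeq (T.covExact ξ 𝒲) N l A W d ε

end Extriangulation

/-- The terms `W₀⁰, W₀¹ ⊞ W₁⁰, W₀² ⊞ W₁¹, …`. -/
noncomputable def splicedTerms {𝒞 : Type u} [Category.{v} 𝒞] [Preadditive 𝒞]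
    [HasZeroObject 𝒞] [HasBinaryBiproducts 𝒞] (W₀ W₁ : ℕ → 𝒞) : ℕ → 𝒞
  | 0 => W₀ 0
  | i + 1 => W₀ (i + 1) ⊞ W₁ i

/-!
The resolution of `X` is the mapping cone of a lift of `X₁ ⟶ X₀` to the given resolutions, built one
syzygy at a time. Let `K₀ i` and `K₁ i` be the syzygies of `X₀` and `X₁`. Composing the deflations
`W₀ 0 ⟶ X₀ ⟶ X`, (ET4)ᵒᵖ gives an `𝔼`-triangle `G 0 ⟶ W₀ 0 ⟶ X` whose fibre `G 0` is an extension
of `X₁` by `K₀ 1`. From then on a horseshoe lemma applies to `K₀ (i + 1) ⟶ G i ⟶ K₁ i`: it covers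
`G i` by `W₀ (i + 1) ⊞ W₁ i`, with a fibre `G (i + 1)` which is an extension of `K₁ (i + 1)` by
`K₀ (i + 2)`.

Both steps rest on `IsProperClass.exists_comp`: deflations of `𝔼`-triangles in `ξ` compose, by
saturation. In the horseshoe lemma, `W₀ (i + 1) ⊞ W₁ i ⟶ G i` is the composite of two deflations
`W_A ⊞ W_C ⟶ A ⊞ W_C ⟶ B`, and both of these come from
`exists_realization_pull_of_lift`, a computation of the homotopy pullback of two deflations with
the same target one of which lifts along the other. `𝒞(𝒲, -)`-exactness and `𝒞(-, 𝒲)`-exactness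
are preserved by each of these constructions.

The `𝒞(-, 𝒲)`-exactness of a given resolution is a priori witnessed by other syzygies than its
`𝒞(𝒲, -)`-exactness. By `contraHomExact_of_isExactSeq` the syzygies agree: a fibre of a deflation
is unique up to isomorphism, and a morphism from an object of `𝒲` to a syzygy `K (i + 1)` is
determined by its composite with `K (i + 1) ⟶ W i`.
-/

/-! ### Extensions and sequences -/

namespace ExtBifunctor

variable {𝒞 : Type u} [Category.{v} 𝒞] (E : ExtBifunctor.{w} 𝒞)

theorem push_id {Z A : 𝒞} (δ : E.ext Z A) : E.push (𝟙 A) δ = δ := by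
  simp [push]

theorem pull_id {Z A : 𝒞} (δ : E.ext Z A) : E.pull (𝟙 Z) δ = δ := by
  simp [pull]

theorem push_push {Z A A' A'' : 𝒞} (a : A ⟶ A') (a' : A' ⟶ A'') (δ : E.ext Z A) :
    E.push a' (E.push a δ) = E.push (a ≫ a') δ := by
  simp [push]

theorem pull_pull {Z Z' Z'' A : 𝒞} (c : Z' ⟶ Z) (c' : Z'' ⟶ Z') (δ : E.ext Z A) :
    E.pull c' (E.pull c δ) = E.pull (c' ≫ c) δ := by
  simp [pull]

theorem pull_push {Z Z' A A' : 𝒞} (a : A ⟶ A') (c : Z' ⟶ Z) (δ : E.ext Z A) :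
    E.pull c (E.push a δ) = E.push a (E.pull c δ) := by
  have h := (E.map c.op).naturality a
  exact (congrArg (fun k => k.hom δ) h)

@[simp]
theorem push_zero {Z A A' : 𝒞} (a : A ⟶ A') : E.push a (0 : E.ext Z A) = 0 := map_zero _

@[simp]
theorem pull_zero {Z Z' A : 𝒞} (c : Z' ⟶ Z) : E.pull c (0 : E.ext Z A) = 0 := map_zero _

theorem push_add_right {Z A A' : 𝒞} (a : A ⟶ A') (δ δ' : E.ext Z A) :
    E.push a (δ + δ') = E.push a δ + E.push a δ' := map_add _ _ _

end ExtBifunctor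

theorem seqClass_eq_of_iso {𝒞 : Type u} [Category.{v} 𝒞] {A B B' Z : 𝒞} {x : A ⟶ B} {y : B ⟶ Z}
    {x' : A ⟶ B'} {y' : B' ⟶ Z} (b : B ≅ B') (hx : x ≫ b.hom = x') (hy : b.hom ≫ y' = y) :
    seqClass x y = seqClass x' y' :=
  Quotient.sound ⟨b, hx, hy⟩

theorem exists_iso_of_seqClass_eq {𝒞 : Type u} [Category.{v} 𝒞] {A B B' Z : 𝒞} {x : A ⟶ B}
    {y : B ⟶ Z} {x' : A ⟶ B'} {y' : B' ⟶ Z} (h : seqClass x y = seqClass x' y') :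
    ∃ b : B ≅ B', x ≫ b.hom = x' ∧ b.hom ≫ y' = y :=
  Quotient.exact h

/-- If `a ≫ b = 1 + N` with `N ≫ N = 0`, then `a ≫ b` has the inverse `1 - N = 2 - a ≫ b`. -/
theorem isIso_of_sub_id_sq_zero {𝒞 : Type u} [Category.{v} 𝒞] [Preadditive 𝒞] {A B : 𝒞}
    (a : A ⟶ B) (b : B ⟶ A) (hab : (a ≫ b - 𝟙 A) ≫ (a ≫ b - 𝟙 A) = 0)
    (hba : (b ≫ a - 𝟙 B) ≫ (b ≫ a - 𝟙 B) = 0) : IsIso a := by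
  have h1 : a ≫ (b ≫ (𝟙 A + 𝟙 A - a ≫ b)) = 𝟙 A := by
    simp only [Preadditive.sub_comp, Preadditive.comp_sub, Preadditive.comp_add, Category.assoc,
      Category.comp_id, Category.id_comp] at hab ⊢
    rw [← sub_eq_zero, ← neg_eq_zero, ← hab]
    abel
  have h2 : ((𝟙 B + 𝟙 B - b ≫ a) ≫ b) ≫ a = 𝟙 B := by
    simp only [Preadditive.sub_comp, Preadditive.comp_sub, Preadditive.add_comp, Category.assoc,
      Category.comp_id, Category.id_comp] at hba ⊢
    rw [← sub_eq_zero, ← neg_eq_zero, ← hba]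
    abel
  have h3 : (𝟙 B + 𝟙 B - b ≫ a) ≫ b = b ≫ (𝟙 A + 𝟙 A - a ≫ b) := by
    simp [Preadditive.sub_comp, Preadditive.comp_sub, Preadditive.add_comp, Preadditive.comp_add]
  exact ⟨_, h1, by rw [← h3]; exact h2⟩

theorem comp_self_eq_zero_of_factor {𝒞 : Type u} [Category.{v} 𝒞] [Preadditive 𝒞] {M Y : 𝒞}
    {φ : M ⟶ M} (p : M ⟶ Y) {t : Y ⟶ M} (ht : p ≫ t = φ) (hp : φ ≫ p = 0) : φ ≫ φ = 0 := by
  calc φ ≫ φ = (φ ≫ p) ≫ t := by rw [Category.assoc, ht]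
    _ = 0 := by rw [hp, zero_comp]

namespace Extriangulation

variable {𝒞 : Type u} [Category.{v} 𝒞] [Preadditive 𝒞] [HasZeroObject 𝒞] [HasBinaryBiproducts 𝒞]
  (T : Extriangulation.{w} 𝒞)

/-! ### Exact sequences of an `𝔼`-triangle -/

theorem s_zero_id (A Z : 𝒞) (hZ : IsZero Z) :
    T.s (0 : T.E.ext Z A) = seqClass (𝟙 A) (0 : A ⟶ Z) := by
  rw [T.s_zero]
  exact seqClass_eq_of_iso ⟨biprod.fst, biprod.inl, by
    ext
    · simp
    · simp
    · exact hZ.eq_of_src _ _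
    · exact hZ.eq_of_src _ _, by simp⟩ (by simp) (hZ.eq_of_tgt _ _)

theorem s_zero_id' (A Z : 𝒞) (hA : IsZero A) :
    T.s (0 : T.E.ext Z A) = seqClass (0 : A ⟶ Z) (𝟙 Z) := by
  rw [T.s_zero]
  exact seqClass_eq_of_iso ⟨biprod.snd, biprod.inr, by
    ext
    · exact hA.eq_of_src _ _
    · exact hA.eq_of_src _ _
    · simp
    · simp, by simp⟩ (by simp) (by simp)

theorem s_zero_swap (A Z : 𝒞) :
    T.s (0 : T.E.ext Z A) = seqClass (biprod.inr : A ⟶ Z ⊞ A) (biprod.fst : Z ⊞ A ⟶ Z) := by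
  rw [T.s_zero]
  exact seqClass_eq_of_iso (biprod.braiding A Z) (by ext <;> simp) (by simp)

variable {T} {A B Z : 𝒞} {x : A ⟶ B} {y : B ⟶ Z} {δ : T.E.ext Z A}

theorem comp_eq_zero (h : T.s δ = seqClass x y) : x ≫ y = 0 := by
  obtain ⟨c, hc, -⟩ := T.et3 (𝟙 A) x (T.s_zero_id A _ (isZero_zero 𝒞)) h rfl
  simpa using hc.symm

theorem exists_lift_of_comp_eq_zero (h : T.s δ = seqClass x y) {P : 𝒞} (u : P ⟶ B)
    (hu : u ≫ y = 0) : ∃ a : P ⟶ A, a ≫ x = u := by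
  obtain ⟨a, ha, -⟩ := T.et3_op u 0 (T.s_zero_id P _ (isZero_zero 𝒞)) h (by simp [hu])
  exact ⟨a, by simpa using ha.symm⟩

theorem exists_desc_of_comp_eq_zero (h : T.s δ = seqClass x y) {I : 𝒞} (u : B ⟶ I)
    (hu : x ≫ u = 0) : ∃ c : Z ⟶ I, y ≫ c = u := by
  obtain ⟨c, hc, -⟩ := T.et3 0 u h (T.s_zero_id' _ I (isZero_zero 𝒞)) (by simp [hu])
  exact ⟨c, by simpa using hc⟩

/-- A morphism lifts along the deflation of an `𝔼`-triangle iff it pulls the extension back to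
zero. -/
theorem pull_eq_zero_iff (h : T.s δ = seqClass x y) {P : 𝒞} (c : P ⟶ Z) :
    T.E.pull c δ = 0 ↔ ∃ u : P ⟶ B, u ≫ y = c := by
  constructor
  · intro hc
    obtain ⟨b, -, hb⟩ := T.realization (𝟙 A) c (T.s_zero A P) h (by simp [hc])
    exact ⟨biprod.inr ≫ b, by simp [← hb]⟩
  · rintro ⟨u, hu⟩
    obtain ⟨a, -, ha⟩ := T.et3_op u c (T.s_zero_id' _ P (isZero_zero 𝒞)) h (by simp [hu])
    simpa using ha.symm

theorem exists_extension_of_push_eq_zero (h : T.s δ = seqClass x y) {I : 𝒞} (a : A ⟶ I)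
    (ha : T.E.push a δ = 0) : ∃ u : B ⟶ I, x ≫ u = a := by
  obtain ⟨b, hb, -⟩ := T.realization a (𝟙 Z) h (T.s_zero I Z) (by simp [ha])
  exact ⟨b ≫ biprod.fst, by rw [← Category.assoc, hb]; simp⟩

theorem push_sub_id (a : A ⟶ A) (ha : T.E.push a δ = δ) : T.E.push (a - 𝟙 A) δ = 0 := by
  have := T.push_add (a - 𝟙 A) (𝟙 A) δ
  rw [sub_add_cancel, ha, T.E.push_id] at this
  simpa using this

theorem covHomExact_iff (h : T.s δ = seqClass x y) (P : 𝒞) :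
    CovHomExact P x y ↔
      (∀ a : P ⟶ A, a ≫ x = 0 → a = 0) ∧ ∀ c : P ⟶ Z, T.E.pull c δ = 0 := by
  constructor
  · rintro ⟨h1, -, h3⟩
    exact ⟨fun a ha => h1 (by simpa using ha), fun c => (pull_eq_zero_iff h c).2 (h3 c)⟩
  · rintro ⟨h1, h3⟩
    refine ⟨fun a a' haa => ?_, fun u => ⟨fun hu => exists_lift_of_comp_eq_zero h u hu, ?_⟩,
      fun c => (pull_eq_zero_iff h c).1 (h3 c)⟩
    · have haa' : a ≫ x = a' ≫ x := haa
      exact sub_eq_zero.1 (h1 _ (by rw [Preadditive.sub_comp, haa', sub_self]))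
    · rintro ⟨a, rfl⟩
      simp [comp_eq_zero h]

theorem contraHomExact_iff (h : T.s δ = seqClass x y) (I : 𝒞) :
    ContraHomExact I x y ↔
      (∀ c : Z ⟶ I, y ≫ c = 0 → c = 0) ∧ ∀ a : A ⟶ I, ∃ u : B ⟶ I, x ≫ u = a := by
  constructor
  · rintro ⟨h1, -, h3⟩
    exact ⟨fun a ha => h1 (by simpa using ha), h3⟩
  · rintro ⟨h1, h3⟩
    refine ⟨fun a a' haa => ?_, fun u => ⟨fun hu => exists_desc_of_comp_eq_zero h u hu, ?_⟩, h3⟩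
    · have haa' : y ≫ a = y ≫ a' := haa
      exact sub_eq_zero.1 (h1 _ (by rw [Preadditive.comp_sub, haa', sub_self]))
    · rintro ⟨a, rfl⟩
      simp [← Category.assoc, comp_eq_zero h]

/-! ### Isomorphisms of `𝔼`-triangles -/

/-- A morphism of extensions which is invertible on both ends is realized by an isomorphism. The
realizations `b`, `b'` of the morphism and of its inverse are only inverse to each other up to
endomorphisms which factor as `y ≫ t`, and these have square zero. -/
theorem exists_iso_mid {A' B' Z' : 𝒞} {x' : A' ⟶ B'} {y' : B' ⟶ Z'} {δ' : T.E.ext Z' A'}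
    (h : T.s δ = seqClass x y) (h' : T.s δ' = seqClass x' y') (a : A ≅ A') (c : Z ≅ Z')
    (hac : T.E.push a.hom δ = T.E.pull c.hom δ') :
    ∃ b : B ≅ B', x ≫ b.hom = a.hom ≫ x' ∧ y ≫ c.hom = b.hom ≫ y' := by
  obtain ⟨b, hxb, hby⟩ := T.realization a.hom c.hom h h' hac
  obtain ⟨b', hxb', hby'⟩ := T.realization a.inv c.inv h' h (by
    rw [← T.E.pull_id (T.E.push a.inv δ'), ← c.inv_hom_id, ← T.E.pull_pull, T.E.pull_push, ← hac,
      T.E.push_push, a.hom_inv_id, T.E.push_id])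
  obtain ⟨t, ht⟩ := exists_desc_of_comp_eq_zero h (b ≫ b' - 𝟙 B)
    (by rw [Preadditive.comp_sub, reassoc_of% hxb, hxb']; simp)
  obtain ⟨t', ht'⟩ := exists_desc_of_comp_eq_zero h' (b' ≫ b - 𝟙 B')
    (by rw [Preadditive.comp_sub, reassoc_of% hxb', hxb]; simp)
  have : IsIso b := by
    refine isIso_of_sub_id_sq_zero b b' (comp_self_eq_zero_of_factor _ ht ?_)
      (comp_self_eq_zero_of_factor _ ht' ?_)
    · rw [Preadditive.sub_comp, Category.assoc, ← hby', ← reassoc_of% hby]; simp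
    · rw [Preadditive.sub_comp, Category.assoc, ← hby, ← reassoc_of% hby']; simp
  exact ⟨asIso b, hxb, hby⟩

theorem s_push_iso (h : T.s δ = seqClass x y) {A' : 𝒞} (a : A ≅ A') :
    T.s (T.E.push a.hom δ) = seqClass (a.inv ≫ x) y := by
  obtain ⟨⟨B', x', y'⟩, h'⟩ := Quotient.exists_rep (T.s (T.E.push a.hom δ))
  replace h' : T.s (T.E.push a.hom δ) = seqClass x' y' := h'.symm
  obtain ⟨b, hxb, hby⟩ := exists_iso_mid h h' a (Iso.refl Z) (T.E.pull_id _).symm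
  rw [h']
  exact (seqClass_eq_of_iso b (by simp [hxb]) (by simp [← hby])).symm

theorem s_pull_iso (h : T.s δ = seqClass x y) {Z' : 𝒞} (c : Z' ≅ Z) :
    T.s (T.E.pull c.hom δ) = seqClass x (y ≫ c.inv) := by
  obtain ⟨⟨B', x', y'⟩, h'⟩ := Quotient.exists_rep (T.s (T.E.pull c.hom δ))
  replace h' : T.s (T.E.pull c.hom δ) = seqClass x' y' := h'.symm
  obtain ⟨b, hxb, hby⟩ := exists_iso_mid h' h (Iso.refl A) c (T.E.push_id _)
  rw [h']
  refine seqClass_eq_of_iso b (by simp [hxb]) ?_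
  rw [← reassoc_of% hby]; simp

/-- The fibre of a deflation is unique up to isomorphism. As in `exists_iso_mid`, the comparison
morphisms are inverse to each other up to endomorphisms of square zero. -/
theorem exists_iso_fibre {A' Z' : 𝒞} {x' : A' ⟶ B} {y' : B ⟶ Z'} {δ' : T.E.ext Z' A'}
    (h : T.s δ = seqClass x y) (h' : T.s δ' = seqClass x' y') (c : Z ≅ Z') (hc : y ≫ c.hom = y') :
    ∃ a : A ≅ A', x = a.hom ≫ x' := by
  obtain ⟨a, ha, hδ⟩ := T.et3_op (𝟙 B) c.hom h h' (by simp [hc])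
  obtain ⟨a', ha', hδ'⟩ := T.et3_op (𝟙 B) c.inv h' h (by simp [← hc])
  rw [Category.comp_id] at ha ha'
  obtain ⟨t, ht⟩ := exists_extension_of_push_eq_zero h (a ≫ a' - 𝟙 A) (push_sub_id _ (by
    rw [← T.E.push_push, hδ, ← T.E.pull_push, hδ', T.E.pull_pull, c.hom_inv_id, T.E.pull_id]))
  obtain ⟨t', ht'⟩ := exists_extension_of_push_eq_zero h' (a' ≫ a - 𝟙 A') (push_sub_id _ (by
    rw [← T.E.push_push, hδ', ← T.E.pull_push, hδ, T.E.pull_pull, c.inv_hom_id, T.E.pull_id]))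
  have : IsIso a := by
    refine isIso_of_sub_id_sq_zero a a' (comp_self_eq_zero_of_factor _ ht ?_)
      (comp_self_eq_zero_of_factor _ ht' ?_)
    · rw [Preadditive.sub_comp, Category.assoc, ← ha', ← ha]; simp
    · rw [Preadditive.sub_comp, Category.assoc, ← ha, ← ha']; simp
  exact ⟨asIso a, ha⟩

/-! ### Two `𝔼`-triangles with the same third term -/

/-- If `μ` is an extension of `Z` by `A₁ ⊕ A₂` with components `δ₁` and `δ₂`, then its middle term
`M` is also the middle term of a realization of `y₂^* δ₁`. The object `P` is any biproduct of
`A₁` and `A₂`. -/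
theorem exists_realization_pull_of_components {P A₁ A₂ B₂ M : 𝒞} {ι : A₁ ⟶ P} {π : P ⟶ A₂}
    {ρ : P ⟶ A₁} (hP : T.s (0 : T.E.ext A₂ A₁) = seqClass ι π) (hρ : ι ≫ ρ = 𝟙 A₁)
    {μ : T.E.ext Z P} {j : P ⟶ M} {q : M ⟶ Z} (hμ : T.s μ = seqClass j q)
    {δ₁ : T.E.ext Z A₁} {δ₂ : T.E.ext Z A₂} (h₁ : T.E.push ρ μ = δ₁) (h₂ : T.E.push π μ = δ₂)
    {x₂ : A₂ ⟶ B₂} {y₂ : B₂ ⟶ Z} (hδ₂ : T.s δ₂ = seqClass x₂ y₂) :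
    ∃ p : M ⟶ B₂, T.s (T.E.pull y₂ δ₁) = seqClass (ι ≫ j) p ∧ p ≫ y₂ = q ∧ j ≫ p = π ≫ x₂ := by
  obtain ⟨G, h', d, e, δ'', hd, he, hs, hde, -, hpush⟩ := T.et4 hP hμ
  rw [h₂, hδ₂] at hde
  obtain ⟨b, hb1, hb2⟩ := exists_iso_of_seqClass_eq hde
  refine ⟨h' ≫ b.inv, ?_, ?_, ?_⟩
  · have key : T.E.pull y₂ δ₁ = T.E.pull b.hom δ'' := by
      rw [← hb2, ← T.E.pull_pull, ← h₁, T.E.pull_push, ← hpush, T.E.push_push, hρ, T.E.push_id]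
    rw [key]
    exact s_pull_iso hs b
  · rw [← hb2]; simp [he]
  · rw [← Category.assoc, ← hd, Category.assoc, ← hb1]; simp

/-- If `f : W ⟶ Z` lifts along the deflation `y : B ⟶ Z` of an `𝔼`-triangle `A ⟶ B ⟶ Z`, and
`f` is itself a deflation with fibre `K`, then the pullback `y^* δ₁` is realized by a sequence
`K ⟶ A ⊕ W ⟶ B`. -/
theorem exists_realization_pull_of_lift {K W : 𝒞} {g : K ⟶ W} {f : W ⟶ Z} {δ₁ : T.E.ext Z K}
    (h₁ : T.s δ₁ = seqClass g f) (h : T.s δ = seqClass x y) (hf : T.E.pull f δ = 0) :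
    ∃ (m : K ⟶ A ⊞ W) (e : A ⊞ W ⟶ B), T.s (T.E.pull y δ₁) = seqClass m e ∧
      m ≫ biprod.snd = g ∧ biprod.inl ≫ e = x ∧ e ≫ y = biprod.snd ≫ f := by
  let μ : T.E.ext Z (K ⊞ A) := T.E.push biprod.inl δ₁ + T.E.push biprod.inr δ
  have push_zero_left {A' A'' : 𝒞} (θ : T.E.ext Z A') :
      T.E.push (0 : A' ⟶ A'') θ = 0 := by
    have := T.push_add (0 : A' ⟶ A'') 0 θ
    simpa using this
  have hμ₁ : T.E.push biprod.fst μ = δ₁ := by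
    simp [μ, T.E.push_add_right, T.E.push_push, push_zero_left, T.E.push_id]
  have hμ₂ : T.E.push biprod.snd μ = δ := by
    simp [μ, T.E.push_add_right, T.E.push_push, push_zero_left, T.E.push_id]
  obtain ⟨⟨M, j, q⟩, hμ⟩ := Quotient.exists_rep (T.s μ)
  replace hμ : T.s μ = seqClass j q := hμ.symm
  obtain ⟨p, hp, hpy, hjp⟩ := exists_realization_pull_of_components (T.s_zero K A)
    biprod.inl_fst hμ hμ₁ hμ₂ h
  obtain ⟨r, hr, hrf, hjr⟩ := exists_realization_pull_of_components (T.s_zero_swap A K)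
    biprod.inr_snd hμ hμ₂ hμ₁ h₁
  rw [hf, T.s_zero] at hr
  obtain ⟨b, hb1, hb2⟩ := exists_iso_of_seqClass_eq hr
  refine ⟨biprod.inl ≫ j ≫ b.inv, b.hom ≫ p, ?_, ?_, ?_, ?_⟩
  · rw [hp]
    exact seqClass_eq_of_iso b.symm (by simp) (by simp)
  · rw [← hb2]; simp [hjr]
  · rw [reassoc_of% hb1, hjp]; simp
  · rw [← hb2, Category.assoc, Category.assoc, hpy, hrf]

/-! ### Exactness of `Hom`-sequences -/

theorem covHomExact_of_iso {A' B' Z' : 𝒞} {x' : A' ⟶ B'} {y' : B' ⟶ Z'} {δ' : T.E.ext Z' A'}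
    (h : T.s δ = seqClass x y) (h' : T.s δ' = seqClass x' y') (a : A ≅ A') (b : B ≅ B')
    (c : Z ≅ Z') (hx : x ≫ b.hom = a.hom ≫ x') (hy : y ≫ c.hom = b.hom ≫ y') {P : 𝒞}
    (hP : CovHomExact P x y) : CovHomExact P x' y' := by
  rw [covHomExact_iff h] at hP
  rw [covHomExact_iff h']
  refine ⟨fun u hu => ?_, fun w => ?_⟩
  · have h0 : u ≫ a.inv = 0 := hP.1 _ (by
      rw [← cancel_mono b.hom, Category.assoc, Category.assoc, hx]; simp [hu])
    rw [← cancel_mono a.inv, h0, zero_comp]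
  · obtain ⟨v, hv⟩ := (pull_eq_zero_iff h _).1 (hP.2 (w ≫ c.inv))
    exact (pull_eq_zero_iff h' w).2 ⟨v ≫ b.hom, by
      rw [Category.assoc, ← hy, reassoc_of% hv]; simp⟩

theorem contraHomExact_of_iso {A' B' Z' : 𝒞} {x' : A' ⟶ B'} {y' : B' ⟶ Z'} {δ' : T.E.ext Z' A'}
    (h : T.s δ = seqClass x y) (h' : T.s δ' = seqClass x' y') (a : A ≅ A') (b : B ≅ B')
    (c : Z ≅ Z') (hx : x ≫ b.hom = a.hom ≫ x') (hy : y ≫ c.hom = b.hom ≫ y') {I : 𝒞}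
    (hI : ContraHomExact I x y) : ContraHomExact I x' y' := by
  rw [contraHomExact_iff h] at hI
  rw [contraHomExact_iff h']
  refine ⟨fun u hu => ?_, fun w => ?_⟩
  · have h0 : c.hom ≫ u = 0 := hI.1 _ (by rw [reassoc_of% hy, hu, comp_zero])
    rw [← cancel_epi c.hom, h0, comp_zero]
  · obtain ⟨v, hv⟩ := hI.2 (a.hom ≫ w)
    refine ⟨b.inv ≫ v, ?_⟩
    rw [← cancel_epi a.hom, ← reassoc_of% hx]; simp [hv]

/-- Exactness of `𝒞(P, -)` on `K ⟶ W ⟶ Z` passes to a realization `K ⟶ M ⟶ B` of a pullback of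
it. -/
theorem covHomExact_pull {K W M : 𝒞} {g : K ⟶ W} {f : W ⟶ Z} {δ₁ : T.E.ext Z K}
    (h₁ : T.s δ₁ = seqClass g f) {m : K ⟶ M} {e : M ⟶ B} {y : B ⟶ Z} {p : M ⟶ W}
    (h : T.s (T.E.pull y δ₁) = seqClass m e) (hp : m ≫ p = g) {P : 𝒞}
    (hP : CovHomExact P g f) : CovHomExact P m e := by
  rw [covHomExact_iff h₁] at hP
  rw [covHomExact_iff h]
  refine ⟨fun u hu => hP.1 u (by rw [← hp, reassoc_of% hu, zero_comp]), fun w => ?_⟩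
  rw [T.E.pull_pull, hP.2]

/-- Exactness of `𝒞(-, I)` on `K ⟶ W ⟶ Z` passes to a realization `K ⟶ M ⟶ B` of its pullback
along the deflation `y` of an `𝔼`-triangle `A ⟶ B ⟶ Z`, provided that `x` factors through `M` and
`M ⟶ W` is an epimorphism. -/
theorem contraHomExact_pull {K W M : 𝒞} {g : K ⟶ W} {f : W ⟶ Z} {δ₁ : T.E.ext Z K}
    (h₁ : T.s δ₁ = seqClass g f) (hδ : T.s δ = seqClass x y) {m : K ⟶ M} {e : M ⟶ B} {p : M ⟶ W}
    [Epi p] {i : A ⟶ M} (h : T.s (T.E.pull y δ₁) = seqClass m e) (hp : m ≫ p = g)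
    (hi : i ≫ e = x) (he : e ≫ y = p ≫ f) {I : 𝒞} (hI : ContraHomExact I g f) :
    ContraHomExact I m e := by
  rw [contraHomExact_iff h₁] at hI
  rw [contraHomExact_iff h]
  refine ⟨fun u hu => ?_, fun w => ?_⟩
  · obtain ⟨v, rfl⟩ := exists_desc_of_comp_eq_zero hδ u (by rw [← hi, Category.assoc, hu, comp_zero])
    have hv : f ≫ v = 0 := by
      rw [← cancel_epi p, ← reassoc_of% he, hu, comp_zero]
    rw [hI.1 v hv, comp_zero]
  · obtain ⟨v, hv⟩ := hI.2 w
    exact ⟨p ≫ v, by rw [reassoc_of% hp, hv]⟩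

/-! ### Composition of deflations -/

variable (T) in
/-- The sequence `A ⟶ B ⟶ Z` together with `δ ∈ 𝔼(Z, A)` is an `𝔼`-triangle in the class `S`. -/
def InClass (S : Set T.ETriangle) {A B Z : 𝒞} (x : A ⟶ B) (y : B ⟶ Z) (δ : T.E.ext Z A) : Prop :=
  ∃ h : T.s δ = seqClass x y, (⟨x, y, δ, h⟩ : T.ETriangle) ∈ S

variable {ξ : Set T.ETriangle} {𝒲 : ObjectProperty 𝒞}

theorem inClass_covExact_iff : T.InClass (T.covExact ξ 𝒲) x y δ ↔
    T.InClass ξ x y δ ∧ ∀ W, 𝒲 W → CovHomExact W x y :=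
  ⟨fun ⟨h, h1, h2⟩ => ⟨⟨h, h1⟩, h2⟩, fun ⟨⟨h, h1⟩, h2⟩ => ⟨h, h1, h2⟩⟩

theorem inClass_contraExact_iff : T.InClass (T.contraExact ξ 𝒲) x y δ ↔
    T.InClass ξ x y δ ∧ ∀ W, 𝒲 W → ContraHomExact W x y :=
  ⟨fun ⟨h, h1, h2⟩ => ⟨⟨h, h1⟩, h2⟩, fun ⟨⟨h, h1⟩, h2⟩ => ⟨h, h1, h2⟩⟩

/-- Composable deflations with `𝔼`-triangles `D ⟶ A ⟶ B` and `F ⟶ B ⟶ Z` in a proper class: the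
composite `A ⟶ Z` has a fibre `G`, which is an extension of `F` by `D`. Both new `𝔼`-triangles lie
in the class: `D ⟶ G ⟶ F` is a base change of the first one, and `G ⟶ A ⟶ Z` becomes a cobase
change of the first one after base change along `B ⟶ Z`, so that saturation applies. -/
theorem IsProperClass.exists_comp (hξ : T.IsProperClass ξ) {D F : 𝒞} {f' : D ⟶ A} {f : A ⟶ B}
    {θ : T.E.ext B D} {g' : F ⟶ B} {g : B ⟶ Z} {θ' : T.E.ext Z F} (h : T.InClass ξ f' f θ)
    (h' : T.InClass ξ g' g θ') :
    ∃ (G : 𝒞) (i : G ⟶ A) (d : D ⟶ G) (e : G ⟶ F) (η : T.E.ext Z G) (τ : T.E.ext F D),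
      T.InClass ξ i (f ≫ g) η ∧ T.InClass ξ d e τ ∧
      (∀ P, CovHomExact P f' f → CovHomExact P g' g →
        CovHomExact P i (f ≫ g) ∧ CovHomExact P d e) ∧
      (∀ I, ContraHomExact I f' f → ContraHomExact I g' g →
        ContraHomExact I i (f ≫ g)) := by
  obtain ⟨hs, hm⟩ := h
  obtain ⟨hs', hm'⟩ := h'
  obtain ⟨G, i, d, e, η, hdi, hie, hη, hde, -, hdg⟩ := T.et4_op hs hs'
  refine ⟨G, i, d, e, η, T.E.pull g' θ, ⟨hη, ?_⟩, ⟨hde, hξ.baseChange hs g' hde hm⟩, ?_, ?_⟩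
  · obtain ⟨⟨M, m, p⟩, hmp⟩ := Quotient.exists_rep (T.s (T.E.push d θ))
    replace hmp : T.s (T.E.push d θ) = seqClass m p := hmp.symm
    have hmem := hξ.cobaseChange hs d hmp hm
    have hmp' : T.s (T.E.pull g η) = seqClass m p := hdg ▸ hmp
    refine hξ.saturated hη hs' hmp' hm' ?_
    simpa only [hdg] using hmem
  · intro P hP hP'
    rw [covHomExact_iff hs] at hP
    have hP'' := (covHomExact_iff hs' P).1 hP'
    rw [covHomExact_iff hη, covHomExact_iff hde]
    refine ⟨⟨fun u hu => ?_, fun w => ?_⟩, fun u hu => hP.1 u ?_, fun w => ?_⟩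
    · have hue : u ≫ e = 0 := hP''.1 _ (by
        rw [Category.assoc, ← hie, reassoc_of% hu, zero_comp])
      obtain ⟨v, rfl⟩ := exists_lift_of_comp_eq_zero hde u hue
      have hv : v = 0 := hP.1 v (by rw [← hdi, ← Category.assoc, hu])
      rw [hv, zero_comp]
    · obtain ⟨v, hv⟩ := (pull_eq_zero_iff hs' _).1 (hP''.2 w)
      obtain ⟨v', hv'⟩ := (pull_eq_zero_iff hs _).1 (hP.2 v)
      exact (pull_eq_zero_iff hη w).2 ⟨v', by rw [reassoc_of% hv', hv]⟩
    · rw [← hdi, reassoc_of% hu, zero_comp]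
    · rw [T.E.pull_pull, hP.2]
  · intro I hI hI'
    rw [contraHomExact_iff hs] at hI
    rw [contraHomExact_iff hs'] at hI'
    rw [contraHomExact_iff hη]
    refine ⟨fun u hu => hI'.1 u (hI.1 _ (by rw [← Category.assoc, hu])), fun w => ?_⟩
    -- extend the restriction of `w` to `D` over `A`; the difference factors through `F`
    obtain ⟨u, hu⟩ := hI.2 (d ≫ w)
    obtain ⟨v, hv⟩ := exists_desc_of_comp_eq_zero hde (w - i ≫ u) (by
      rw [Preadditive.comp_sub, reassoc_of% hdi, hu, sub_self])
    obtain ⟨v', rfl⟩ := hI'.2 v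
    refine ⟨u + f ≫ v', ?_⟩
    rw [Preadditive.comp_add, reassoc_of% hie, hv]
    abel

/-- The horseshoe lemma. Since `W_C ⟶ Z` lifts to `B`, there is an `𝔼`-triangle
`K_C ⟶ A ⊕ W_C ⟶ B`, and `W_A ⊕ W_C ⟶ B` is the composite of the deflations
`W_A ⊕ W_C ⟶ A ⊕ W_C ⟶ B`. -/
theorem IsProperClass.horseshoe (hξ : T.IsProperClass ξ) (hB : T.InClass (T.covExact ξ 𝒲) x y δ)
    {KA WA KC WC : 𝒞} {gA : KA ⟶ WA} {fA : WA ⟶ A} {δA : T.E.ext A KA}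
    (hA : T.InClass (T.covExact ξ 𝒲) gA fA δA)
    {gC : KC ⟶ WC} {fC : WC ⟶ Z} {δC : T.E.ext Z KC}
    (hC : T.InClass (T.covExact ξ 𝒲) gC fC δC) (hWC : 𝒲 WC) :
    ∃ (KB : 𝒞) (k : KA ⟶ KB) (k' : KB ⟶ KC) (τ : T.E.ext KC KA) (g : KB ⟶ WA ⊞ WC)
      (f : WA ⊞ WC ⟶ B) (δB : T.E.ext B KB),
      T.InClass (T.covExact ξ 𝒲) k k' τ ∧ T.InClass (T.covExact ξ 𝒲) g f δB ∧
      ∀ I, ContraHomExact I gA fA → ContraHomExact I gC fC → ContraHomExact I g f := by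
  simp only [inClass_covExact_iff] at hA hB hC ⊢
  obtain ⟨⟨hsB, -⟩, hcB⟩ := hB
  obtain ⟨⟨hsA, hmA⟩, hcA⟩ := hA
  obtain ⟨⟨hsC, hmC⟩, hcC⟩ := hC
  obtain ⟨m, e, hme, hm, hi, he⟩ := exists_realization_pull_of_lift hsC hsB
    (((covHomExact_iff hsB _).1 (hcB WC hWC)).2 fC)
  obtain ⟨m', e', hme', hm', hi', he'⟩ := exists_realization_pull_of_lift hsA
    (T.s_zero_swap WC A) (T.E.pull_zero fA)
  have hme'' : T.s (T.E.pull (biprod.fst : A ⊞ WC ⟶ A) δA) =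
      seqClass (m' ≫ (biprod.braiding WC WA).hom) ((biprod.braiding WC WA).inv ≫ e') :=
    hme'.trans (seqClass_eq_of_iso (biprod.braiding WC WA) rfl (by simp))
  have hfst : (m' ≫ (biprod.braiding WC WA).hom) ≫ biprod.fst = gA := by simp [hm']
  have hinr : biprod.inr ≫ (biprod.braiding WC WA).inv ≫ e' = biprod.inr := by
    rw [← hi', ← Category.assoc]
    congr 1
    ext <;> simp
  have hsq : ((biprod.braiding WC WA).inv ≫ e') ≫ biprod.fst = biprod.fst ≫ fA := by
    rw [Category.assoc, he', ← Category.assoc]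
    congr 1
    simp
  obtain ⟨G, i, d, d', η, τ, hη, hτ, hcov, hcontra⟩ := hξ.exists_comp
    ⟨hme'', hξ.baseChange hsA _ hme'' hmA⟩ ⟨hme, hξ.baseChange hsC _ hme hmC⟩
  have hcov' W (hW : 𝒲 W) := hcov W (covHomExact_pull hsA hme'' hfst (hcA W hW))
    (covHomExact_pull hsC hme hm (hcC W hW))
  exact ⟨G, d, d', τ, i, _, η, ⟨hτ, fun W hW => (hcov' W hW).2⟩,
    ⟨hη, fun W hW => (hcov' W hW).1⟩, fun I hIA hIC => hcontra I
      (contraHomExact_pull hsA (T.s_zero_swap WC A) hme'' hfst hinr hsq hIA)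
      (contraHomExact_pull hsC hsB hme hm hi he hIC)⟩

/-! ### Resolutions -/

/-- The objects `Kᵢ` through which a sequence of objects of `𝒲` is spliced from
`𝒞(𝒲, -)`-exact `𝔼`-triangles are unique up to isomorphism, so if the sequence can be spliced from
`𝒞(-, 𝒲)`-exact `𝔼`-triangles as well, then the given ones are `𝒞(-, 𝒲)`-exact. -/
theorem contraHomExact_of_isExactSeq {N : ℕ∞} {l : LeftEnd} {X : 𝒞} {W : ℕ → 𝒞}
    {d : ∀ i, W (i + 1) ⟶ W i} {ε : W 0 ⟶ X} (hW : ∀ i : ℕ, (i : ℕ∞) < N → 𝒲 (W i))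
    {K : ℕ → 𝒞} {α : K 0 ≅ X} {g : ∀ i, K (i + 1) ⟶ W i} {f : ∀ i, W i ⟶ K i}
    {δ : ∀ i, T.E.ext (K i) (K (i + 1))}
    (hK : ∀ i : ℕ, (i : ℕ∞) < N → T.InClass (T.covExact ξ 𝒲) (g i) (f i) (δ i))
    (hε : 0 < N → ε = f 0 ≫ α.hom)
    (hd : ∀ i : ℕ, ((i + 1 : ℕ) : ℕ∞) < N → d i = f (i + 1) ≫ g i)
    (h : T.IsExactSeq (T.contraExact ξ 𝒲) N l X W d ε) (i : ℕ) (hi : (i : ℕ∞) < N) (I : 𝒞)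
    (hI : 𝒲 I) : ContraHomExact I (g i) (f i) := by
  obtain ⟨-, -, K', α', g', f', δ', hK', hε', hd', -⟩ := h
  have hfib (i : ℕ) (hi : (i : ℕ∞) < N) (φ : K i ≅ K' i) (hφ : f i ≫ φ.hom = f' i) :
      ∃ ψ : K (i + 1) ≅ K' (i + 1), g i = ψ.hom ≫ g' i :=
    exists_iso_fibre (hK i hi).1 (hK' i hi).1 φ hφ
  have key (i : ℕ) : (i : ℕ∞) < N → ∃ φ : K i ≅ K' i, f i ≫ φ.hom = f' i := by
    induction i with
    | zero =>
      intro h0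
      rw [Nat.cast_zero] at h0
      exact ⟨α ≪≫ α'.symm, by
        rw [Iso.trans_hom, ← Category.assoc, ← hε h0, hε' h0]; simp⟩
    | succ i ih =>
      intro hi
      have hi' : (i : ℕ∞) < N := lt_trans (by exact_mod_cast i.lt_succ_self) hi
      obtain ⟨φ, hφ⟩ := ih hi'
      obtain ⟨ψ, hψ⟩ := hfib i hi' φ hφ
      refine ⟨ψ, ?_⟩
      have hinj := ((covHomExact_iff (hK i hi').1 _).1 ((hK i hi').2.2 _ (hW (i + 1) hi))).1
      -- both sides agree after composition with `g i`, and `𝒞(W (i + 1), g i)` is injective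
      have hz := hinj (f (i + 1) - f' (i + 1) ≫ ψ.inv) (by
        rw [Preadditive.sub_comp, Category.assoc, ← hd i hi, hψ, ψ.inv_hom_id_assoc, ← hd' i hi,
          sub_self])
      rw [sub_eq_zero.1 hz]
      simp
  obtain ⟨φ, hφ⟩ := key i hi
  obtain ⟨ψ, hψ⟩ := hfib i hi φ hφ
  refine contraHomExact_of_iso (hK' i hi).1 (hK i hi).1 ψ.symm (Iso.refl _) φ.symm ?_ ?_
    ((hK' i hi).2.2 I hI)
  · simp [hψ]
  · simp [← hφ]

theorem isExactSeq_of_inClass {S : Set T.ETriangle} {N : ℕ∞} {l : LeftEnd} {W K : ℕ → 𝒞}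
    {g : ∀ i, K (i + 1) ⟶ W i} {f : ∀ i, W i ⟶ K i} {δ : ∀ i, T.E.ext (K i) (K (i + 1))}
    (h : ∀ i : ℕ, (i : ℕ∞) < N → T.InClass S (g i) (f i) (δ i))
    (hl : l = LeftEnd.zero → ∀ n : ℕ, (n : ℕ∞) = N → IsZero (K n)) :
    T.IsExactSeq S N l (K 0) W (fun i => f (i + 1) ≫ g i) (f 0) := by
  refine ⟨fun hN => ?_, fun i hi => ?_, K, Iso.refl _, g, f, δ, h, by simp, by simp, hl⟩
  · rw [Category.assoc, comp_eq_zero (h 0 (lt_trans (by simp) hN)).1, comp_zero]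
  · have hi' : ((i + 1 : ℕ) : ℕ∞) < N := lt_trans (by exact_mod_cast (i + 1).lt_succ_self) hi
    simp only [Category.assoc]
    rw [← Category.assoc (g (i + 1)), comp_eq_zero (h (i + 1) hi').1, zero_comp, comp_zero]

/-- A sequence `A ⟶ G ⟶ Z` with fixed end terms, together with an element of `𝔼(Z, A)` which is
not required to be realized by it. Unlike `𝔼`-triangles, these exist for trivial reasons, so that a
sequence of them can be continued beyond the end of a finite resolution. -/
structure PreTriangle (T : Extriangulation.{w} 𝒞) (A Z : 𝒞) where
  G : 𝒞
  p : A ⟶ G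
  q : G ⟶ Z
  τ : T.E.ext Z A

end Extriangulation

theorem exists_dependent_seq {α : ℕ → Type*} (R : ∀ i, α i → α (i + 1) → Prop) (a : α 0)
    (h : ∀ i a, ∃ b, R i a b) : ∃ s : ∀ i, α i, s 0 = a ∧ ∀ i, R i (s i) (s (i + 1)) := by
  choose F hF using h
  exact ⟨fun i => Nat.rec a F i, rfl, fun i => hF i _⟩

open Extriangulation in
theorem mainTheorem4 {𝒞 : Type u} [Category.{v} 𝒞] [Preadditive 𝒞] [HasZeroObject 𝒞]
    [HasBinaryBiproducts 𝒞]
    (T : Extriangulation.{w} 𝒞) (hWIC : T.WIC)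
    (ξ : Set T.ETriangle) (hξ : T.IsProperClass ξ)
    (hproj : T.EnoughProjectives ξ) (hinj : T.EnoughInjectives ξ)
    (𝒲 : ObjectProperty 𝒞) (h𝒲 : ∀ U V : 𝒞, 𝒲 U → 𝒲 V → 𝒲 (U ⊞ V))
    {X₁ X₀ X : 𝒞} (x : X₁ ⟶ X₀) (y : X₀ ⟶ X) (δ : T.E.ext X X₁) (hδ : T.s δ = seqClass x y)
    (hcov : (⟨x, y, δ, hδ⟩ : T.ETriangle) ∈ T.covExact ξ 𝒲)
    (n : ℕ∞) (l : LeftEnd)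
    (W₀ : ℕ → 𝒞) (d₀ : ∀ i, W₀ (i + 1) ⟶ W₀ i) (ε₀ : W₀ 0 ⟶ X₀)
    (h₀ : T.IsProperResolution ξ 𝒲 (n + 1) l X₀ W₀ d₀ ε₀)
    (W₁ : ℕ → 𝒞) (d₁ : ∀ i, W₁ (i + 1) ⟶ W₁ i) (ε₁ : W₁ 0 ⟶ X₁)
    (h₁ : T.IsProperResolution ξ 𝒲 n l X₁ W₁ d₁ ε₁) :
    ∃ (d : ∀ i, splicedTerms W₀ W₁ (i + 1) ⟶ splicedTerms W₀ W₁ i)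
      (ε : splicedTerms W₀ W₁ 0 ⟶ X),
      T.IsProperResolution ξ 𝒲 (n + 1) l X (splicedTerms W₀ W₁) d ε ∧
      ((⟨x, y, δ, hδ⟩ : T.ETriangle) ∈ T.contraExact ξ 𝒲 →
        T.IsExactSeq (T.contraExact ξ 𝒲) (n + 1) l X₀ W₀ d₀ ε₀ →
        T.IsExactSeq (T.contraExact ξ 𝒲) n l X₁ W₁ d₁ ε₁ →
        T.IsExactSeq (T.contraExact ξ 𝒲) (n + 1) l X (splicedTerms W₀ W₁) d ε) := by
  have hpos : (0 : ℕ∞) < n + 1 := by simp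
  have hlt (i : ℕ) : ((i + 1 : ℕ) : ℕ∞) < n + 1 ↔ (i : ℕ∞) < n := by
    simp
  obtain ⟨hW₀, -, -, K₀, α₀, g₀, f₀, δ₀, hK₀, hε₀, hd₀, hl₀⟩ := h₀
  obtain ⟨hW₁, -, -, K₁, α₁, g₁, f₁, δ₁, hK₁, hε₁, hd₁, hl₁⟩ := h₁
  -- replace `X₁ ⟶ X₀ ⟶ X` by an isomorphic `𝔼`-triangle starting with `K₁ 0 ⟶ K₀ 0`
  let x' : K₁ 0 ⟶ K₀ 0 := α₁.hom ≫ x ≫ α₀.inv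
  let y' : K₀ 0 ⟶ X := α₀.hom ≫ y
  let δ' : T.E.ext X (K₁ 0) := T.E.push α₁.inv δ
  have hs' : T.s δ' = seqClass x' y' :=
    (s_push_iso hδ α₁.symm).trans (seqClass_eq_of_iso α₀.symm (by simp [x']) (by simp [y']))
  have hx' : x ≫ α₀.symm.hom = α₁.symm.hom ≫ x' := by simp [x']
  have hy' : y ≫ (Iso.refl X).hom = α₀.symm.hom ≫ y' := by simp [y']
  have hξ' : T.InClass ξ x' y' δ' :=
    ⟨hs', hξ.iso_closed _ _ hcov.1 ⟨α₁.symm, α₀.symm, Iso.refl X, hx', hy', by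
      simp [δ', T.E.pull_id]⟩⟩
  have hcov' W (hW : 𝒲 W) : CovHomExact W x' y' :=
    covHomExact_of_iso hδ hs' α₁.symm α₀.symm (Iso.refl X) hx' hy' (hcov.2 W hW)
  have hcov₀ := inClass_covExact_iff.1 (hK₀ 0 hpos)
  obtain ⟨G, i, p, q, η, τ, hη, hτ, hcovG, hcontraG⟩ := hξ.exists_comp hcov₀.1 hξ'
  have hcovG' W (hW : 𝒲 W) := hcovG W (hcov₀.2 W hW) (hcov' W hW)
  -- the objects `G i` sit in `𝔼`-triangles `K₀ (i + 1) ⟶ G i ⟶ K₁ i`; apply the horseshoe lemma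
  -- repeatedly
  let good (i : ℕ) (t : T.PreTriangle (K₀ (i + 1)) (K₁ i)) : Prop :=
    T.InClass (T.covExact ξ 𝒲) t.p t.q t.τ
  obtain ⟨t, ht0, ht⟩ := exists_dependent_seq (α := fun i => T.PreTriangle (K₀ (i + 1)) (K₁ i))
    (fun i t t' => (i : ℕ∞) < n → good i t → good (i + 1) t' ∧
      ∃ (g : t'.G ⟶ W₀ (i + 1) ⊞ W₁ i) (f : W₀ (i + 1) ⊞ W₁ i ⟶ t.G) (θ : T.E.ext t.G t'.G),
        T.InClass (T.covExact ξ 𝒲) g f θ ∧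
        ∀ I, ContraHomExact I (g₀ (i + 1)) (f₀ (i + 1)) → ContraHomExact I (g₁ i) (f₁ i) →
          ContraHomExact I g f)
    ⟨G, p, q, τ⟩ (by
      intro i t
      by_cases h : (i : ℕ∞) < n ∧ good i t
      · obtain ⟨KB, k, k', τ, g, f, θ, h1, h2, h3⟩ := hξ.horseshoe h.2
          (hK₀ (i + 1) ((hlt i).2 h.1)) (hK₁ i h.1) (hW₁ i h.1)
        exact ⟨⟨KB, k, k', τ⟩, fun _ _ => ⟨h1, g, f, θ, h2, h3⟩⟩
      · exact ⟨⟨X, 0, 0, 0⟩, fun h1 h2 => absurd ⟨h1, h2⟩ h⟩)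
  have hgood (i : ℕ) : (i : ℕ∞) < n + 1 → good i (t i) := by
    induction i with
    | zero =>
      intro _
      rw [ht0]
      exact inClass_covExact_iff.2 ⟨hτ, fun W hW => (hcovG' W hW).2⟩
    | succ i ih =>
      intro hi
      exact (ht i ((hlt i).1 hi) (ih (lt_trans (by exact_mod_cast i.lt_succ_self) hi))).1
  have ht0' : ∃ (g : (t 0).G ⟶ W₀ 0) (θ : T.E.ext X (t 0).G), T.InClass ξ g (f₀ 0 ≫ y') θ ∧
      (∀ W, 𝒲 W → CovHomExact W g (f₀ 0 ≫ y')) ∧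
      ∀ I, ContraHomExact I (g₀ 0) (f₀ 0) → ContraHomExact I x' y' →
        ContraHomExact I g (f₀ 0 ≫ y') := by
    rw [ht0]
    exact ⟨i, η, hη, fun W hW => (hcovG' W hW).1, hcontraG⟩
  let L : ℕ → 𝒞 := fun i => Nat.casesOn i X fun i => (t i).G
  -- the condition under which all `𝔼`-triangles used in the construction are `𝒞(-, 𝒲)`-exact
  let Contra : Prop := (∀ I, 𝒲 I → ContraHomExact I x' y') ∧
    (∀ i : ℕ, (i : ℕ∞) < n + 1 → ∀ I, 𝒲 I → ContraHomExact I (g₀ i) (f₀ i)) ∧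
    (∀ i : ℕ, (i : ℕ∞) < n → ∀ I, 𝒲 I → ContraHomExact I (g₁ i) (f₁ i))
  have hL (i : ℕ) : ∃ (g : L (i + 1) ⟶ splicedTerms W₀ W₁ i) (f : splicedTerms W₀ W₁ i ⟶ L i)
      (θ : T.E.ext (L i) (L (i + 1))), (i : ℕ∞) < n + 1 →
        T.InClass (T.covExact ξ 𝒲) g f θ ∧
        (Contra → T.InClass (T.contraExact ξ 𝒲) g f θ) := by
    cases i with
    | zero =>
      obtain ⟨g, θ, hθ, hcovθ, hcontraθ⟩ := ht0'
      exact ⟨g, f₀ 0 ≫ y', θ, fun _ => ⟨inClass_covExact_iff.2 ⟨hθ, hcovθ⟩, fun hc =>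
        inClass_contraExact_iff.2 ⟨hθ, fun I hI => hcontraθ I (hc.2.1 0 hpos I hI) (hc.1 I hI)⟩⟩⟩
    | succ i =>
      change ∃ (g : (t (i + 1)).G ⟶ W₀ (i + 1) ⊞ W₁ i) (f : W₀ (i + 1) ⊞ W₁ i ⟶ (t i).G)
        (θ : T.E.ext (t i).G (t (i + 1)).G), _
      by_cases hi : ((i + 1 : ℕ) : ℕ∞) < n + 1
      · have hi' := (hlt i).1 hi
        obtain ⟨-, g, f, θ, h1, h2⟩ := ht i hi'
          (hgood i (lt_trans (by exact_mod_cast i.lt_succ_self) hi))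
        exact ⟨g, f, θ, fun _ => ⟨h1, fun hc => inClass_contraExact_iff.2
          ⟨(inClass_covExact_iff.1 h1).1, fun I hI =>
            h2 I (hc.2.1 _ hi I hI) (hc.2.2 i hi' I hI)⟩⟩⟩
      · exact ⟨0, 0, 0, fun h => absurd h hi⟩
  choose g f θ hgf using hL
  have hzero : l = LeftEnd.zero → ∀ m : ℕ, (m : ℕ∞) = n + 1 → IsZero (L m) := by
    intro hl m hm
    cases m with
    | zero => exact absurd (Nat.cast_zero.symm.trans hm) hpos.ne
    | succ m =>
      have hmn : (m : ℕ∞) = n := by simpa using hm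
      have hz₀ := hl₀ hl (m + 1) hm
      have hz₁ := hl₁ hl m hmn
      have hG : good m (t m) := hgood m (by rw [← hmn]; exact_mod_cast m.lt_succ_self)
      -- the identity of `G m` factors through `K₀ (m + 1) = 0`
      obtain ⟨a, ha⟩ := exists_lift_of_comp_eq_zero hG.1 (𝟙 _) (hz₁.eq_of_tgt _ _)
      exact (IsZero.iff_id_eq_zero _).2 (by rw [← ha, hz₀.eq_zero_of_tgt a, zero_comp])
  refine ⟨fun i => f (i + 1) ≫ g i, f 0, ⟨fun i hi => ?_,
    isExactSeq_of_inClass (K := L) (fun i hi => (hgf i hi).1) hzero⟩, fun hc hc₀ hc₁ =>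
    isExactSeq_of_inClass (K := L) (fun i hi => (hgf i hi).2 ⟨fun I hI => ?_, ?_, ?_⟩) hzero⟩
  · cases i with
    | zero => exact hW₀ 0 hi
    | succ i => exact h𝒲 _ _ (hW₀ _ hi) (hW₁ i ((hlt i).1 hi))
  · exact contraHomExact_of_iso hδ hs' α₁.symm α₀.symm (Iso.refl X) hx' hy' (hc.2 I hI)
  · exact contraHomExact_of_isExactSeq hW₀ hK₀ hε₀ hd₀ hc₀
  · exact contraHomExact_of_isExactSeq hW₁ hK₁ hε₁ hd₁ hc₁
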